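/- Theorem 3.2. For every $c_0>0$ there is a constant $c>0$ depending only on $c_0$ such that the following holds. Let $d\ge 1$, $L>0$, and let $M\ge 2$ and $n\ge 1$ be integers with $M\le c_0 n$. Let $\mathcal P_0$ be the class of all probability densities $p$ on $\mathbb R^d$ with $\|p\|_\infty\le L$, and let $$\Lambda^M=\Big\{\lambda\in\mathbb R^M:\ \lambda_j\ge 0\ (j=1,\dots,M),\ \sum_{j=1}^M\lambda_j\le 1\Big\}.$$ Then there exist functions $p_1,\dots,p_M\in L_2(\mathbb R^d)$ such that $$\inf_{T_n}\ \sup_{p\in\mathcal P_0}\Big[E_p^n\|T_n-p\|^2-\inf_{\lambda\in\Lambda^M}\Big\|\sum_{j=1}^M\lambda_jp_j-p\Big\|^2\Big]\ \ge\ \frac{cLM}{n},$$ where $\|\cdot\|$ is the norm of $L_2(\mathbb R^d)$, the first infimum is over all estimators $T_n$ (jointly measurable real functions $T_n(X_1,\dots,X_n;x)$ of the sample and of $x\in\mathbb R^d$), and $E_p^n$ is the expectation when $X_1,\dots,X_n$ are i.i.d. with density $p$; the risk $E_p^n\|T_n-p\|^2$ may be $+\infty$. -/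

import Mathlib

open MeasureTheory
open scoped ENNReal

noncomputable section

namespace DensityAggregation

/-- The class of all probability densities on `ℝ^d` (w.r.t. Lebesgue measure) that are
bounded by `L` in the `L_∞` norm. -/
def boundedDensities (d : ℕ) (L : ℝ) : Set (EuclideanSpace ℝ (Fin d) → ℝ) :=
  {p | (∀ x, 0 ≤ p x) ∧ Integrable p volume ∧ ∫ x, p x = 1 ∧
    eLpNorm p ∞ volume ≤ ENNReal.ofReal L}

/-- The set `Λ^M` of nonnegative weights `w ∈ ℝ^M` with sum at most one. -/
def weightSimplex (M : ℕ) : Set (Fin M → ℝ) :=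
  {w | (∀ j, 0 ≤ w j) ∧ ∑ j, w j ≤ 1}

/-- The linear combination `p_w = ∑ j, w j • p_j`. -/
def combination {d M : ℕ} (p : Fin M → EuclideanSpace ℝ (Fin d) → ℝ) (w : Fin M → ℝ) :
    EuclideanSpace ℝ (Fin d) → ℝ :=
  fun x => ∑ j, w j * p j x

/-- The law of an i.i.d. sample `(X_1, …, X_n)` with common density `p`. -/
def sampleLaw {d : ℕ} (n : ℕ) (p : EuclideanSpace ℝ (Fin d) → ℝ) :
    Measure (Fin n → EuclideanSpace ℝ (Fin d)) :=
  Measure.pi fun _ => volume.withDensity fun x => ENNReal.ofReal (p x)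

/-- Estimators of a density on `ℝ^d` from a sample of size `n`: real functions `T X x` of the
sample `X` and the point `x`, jointly measurable. -/
def estimators (d n : ℕ) :
    Set ((Fin n → EuclideanSpace ℝ (Fin d)) → EuclideanSpace ℝ (Fin d) → ℝ) :=
  {T | Measurable (Function.uncurry T)}

/-- The squared `L_2` distance `‖f - g‖²`, equal to `∞` if `f - g` is not square integrable. -/
def sqDist {d : ℕ} (f g : EuclideanSpace ℝ (Fin d) → ℝ) : ℝ≥0∞ :=
  eLpNorm (fun x => f x - g x) 2 volume ^ 2

/-- The `L_2`-risk `R_n(T, p) = E_p^n ‖T - p‖²`. -/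
def risk {d n : ℕ} (T : (Fin n → EuclideanSpace ℝ (Fin d)) → EuclideanSpace ℝ (Fin d) → ℝ)
    (p : EuclideanSpace ℝ (Fin d) → ℝ) : ℝ≥0∞ :=
  ∫⁻ X, sqDist (T X) p ∂(sampleLaw n p)

/-- The excess risk `R_n(T, q) - inf_{w ∈ H} ‖p_w - q‖²`. The infimum is finite whenever `H` is
nonempty and `q`, `p_1, …, p_M` are square integrable. -/
def excessRisk {d n M : ℕ} (H : Set (Fin M → ℝ)) (p : Fin M → EuclideanSpace ℝ (Fin d) → ℝ)
    (T : (Fin n → EuclideanSpace ℝ (Fin d)) → EuclideanSpace ℝ (Fin d) → ℝ)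
    (q : EuclideanSpace ℝ (Fin d) → ℝ) : EReal :=
  (risk T q : EReal) - ((⨅ w ∈ H, sqDist (combination p w) q : ℝ≥0∞) : EReal)

end DensityAggregation

end

open scoped NNReal

namespace DensityAggregation

/-! ### Densities of product measures. -/

section ProductDensity

variable {α : Type*} [MeasurableSpace α] {μ : Measure α} [SigmaFinite μ]

/-! With `N = M - 1`, take a uniform density of height `a = L / 2` on `N` blocks, each made of two
cells of equal volume. A bit of `σ` switches on, in its block, the relative perturbation `+δ` on one
cell and `-δ` on the other; the integral stays 1, and the height stays at most `L` when `δ ≤ 1`. The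
dictionary is a rescaled base function and `N` rescaled perturbations. They need not be densities,
so every vertex of the hypercube is a combination with weights in the simplex
(`exists_weights_eq_vertexValue`). The oracle term is then zero, and it remains to bound the worst
risk over the vertices.

This is Assouad's argument (`exists_risk_ge`). Neighbouring vertices have affinity at least `1 - δ²
/ (2N)`, hence at least `1/2` after `n` observations if `n δ² ≤ N`, and `two_point_bound` forces a
loss in each block. The blocks together give a risk of order `a δ²`; with `δ²` of order `N / n` this
is `L M / n`. -/

/-- Tonelli's theorem for a product of functions of the separate coordinates. -/
theorem lintegral_pi_prod {n : ℕ} (f : Fin n → α → ℝ≥0∞) (hf : ∀ i, Measurable (f i)) :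
    ∫⁻ x, ∏ i, f i (x i) ∂(Measure.pi fun _ : Fin n => μ) = ∏ i, ∫⁻ x, f i x ∂μ := by
  induction n with
  | zero => simp
  | succ n ih =>
    rw [← (measurePreserving_piFinSuccAbove (fun _ : Fin (n + 1) => μ) 0).symm.lintegral_comp_emb
      (MeasurableEquiv.measurableEmbedding _)]
    simp_rw [MeasurableEquiv.piFinSuccAbove_symm_apply, Fin.insertNthEquiv,
      Fin.prod_univ_succ, Fin.insertNth_zero, Equiv.coe_fn_mk, Fin.cons_succ, Fin.cons_zero]
    rw [← ih (fun i => f i.succ) fun i => hf i.succ]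
    exact lintegral_prod_mul (hf 0).aemeasurable
      (Finset.measurable_prod _ fun (i : Fin n) _ =>
        (hf i.succ).comp (measurable_pi_apply i)).aemeasurable

/-- The product of measures with densities has the product density. -/
theorem pi_withDensity {n : ℕ} {f : α → ℝ≥0∞} (hf : Measurable f)
    [SigmaFinite (μ.withDensity f)] :
    (Measure.pi fun _ : Fin n => μ.withDensity f) =
      (Measure.pi fun _ : Fin n => μ).withDensity fun x => ∏ i, f (x i) := by
  refine Measure.pi_eq fun s hs => ?_
  rw [withDensity_apply _ (MeasurableSet.univ_pi hs), ← lintegral_indicator (.univ_pi hs)]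
  have h : ((Set.univ.pi s).indicator fun x : Fin n → α => ∏ i, f (x i)) =
      fun x => ∏ i, (s i).indicator f (x i) := by
    ext x
    by_cases hx : x ∈ Set.univ.pi s
    · rw [Set.indicator_of_mem hx]
      exact Finset.prod_congr rfl fun i _ => (Set.indicator_of_mem (hx i trivial) _).symm
    · rw [Set.indicator_of_notMem hx]
      obtain ⟨i, hi⟩ : ∃ i, x i ∉ s i := by simpa [Set.mem_pi] using hx
      exact (Finset.prod_eq_zero (Finset.mem_univ i) (Set.indicator_of_notMem hi _)).symm
  rw [h, lintegral_pi_prod _ fun i => hf.indicator (hs i)]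
  exact Finset.prod_congr rfl fun i _ => by
    rw [lintegral_indicator (hs i), withDensity_apply _ (hs i)]

end ProductDensity

/-! ### Testing two densities through their Hellinger affinity. -/

/-- A lower bound for the minimum of two numbers through their geometric and arithmetic means. -/
theorem six_mul_sqrt_mul_le (p q : ℝ≥0) :
    6 * NNReal.sqrt (p * q) ≤ 8 * min p q + (p + q) := by
  wlog h : p ≤ q generalizing p q
  · rw [mul_comm p, min_comm, add_comm p]
    exact this q p (le_of_not_ge h)
  rw [min_eq_left h, NNReal.sqrt_mul, ← NNReal.coe_le_coe]
  conv_rhs => rw [← NNReal.sq_sqrt p, ← NNReal.sq_sqrt q]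
  push_cast
  -- For `p ≤ q` the claim is `6 √p √q ≤ 9 p + q`, a perfect square.
  nlinarith [sq_nonneg (3 * √(p : ℝ) - √(q : ℝ))]

/-- The two-point bound: if the Hellinger affinity of the `n`-fold products is at least `1 / 2`,
no sample-based procedure can keep both risks below `b / 8`. -/
theorem two_point_bound {α : Type*} [MeasurableSpace α] {μ : Measure α} [SigmaFinite μ] {n : ℕ}
    {f g : α → ℝ≥0} (hf : Measurable f) (hg : Measurable g)
    (hf1 : ∫⁻ x, f x ∂μ = 1) (hg1 : ∫⁻ x, g x ∂μ = 1)
    (haff : 1 ≤ 2 * (∫⁻ x, NNReal.sqrt (f x * g x) ∂μ) ^ n)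
    {H K : (Fin n → α) → ℝ≥0∞} (hH : Measurable H) (hK : Measurable K) {b : ℝ≥0∞}
    (hb : ∀ X, b ≤ H X + K X) :
    b ≤ 8 * (∫⁻ X, H X ∂(Measure.pi fun _ => μ.withDensity fun x => f x) +
      ∫⁻ X, K X ∂(Measure.pi fun _ => μ.withDensity fun x => g x)) := by
  have hfm : Measurable fun x => (f x : ℝ≥0∞) := hf.coe_nnreal_ennreal
  have hgm : Measurable fun x => (g x : ℝ≥0∞) := hg.coe_nnreal_ennreal
  let F : (Fin n → α) → ℝ≥0 := fun X => ∏ i, f (X i)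
  let G : (Fin n → α) → ℝ≥0 := fun X => ∏ i, g (X i)
  have hF : Measurable F := Finset.measurable_prod _ fun i _ => hf.comp (measurable_pi_apply i)
  have hG : Measurable G := Finset.measurable_prod _ fun i _ => hg.comp (measurable_pi_apply i)
  have hprod : ∀ h : α → ℝ≥0, Measurable h →
      ∫⁻ X, ((∏ i, h (X i) : ℝ≥0) : ℝ≥0∞) ∂(Measure.pi fun _ : Fin n => μ) =
        (∫⁻ x, h x ∂μ) ^ n := fun h hh => by
    simp_rw [ENNReal.ofNNReal_finsetProd]
    rw [lintegral_pi_prod (fun _ x => (h x : ℝ≥0∞)) fun _ => hh.coe_nnreal_ennreal]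
    simp
  have hmin : 1 ≤ 8 * ∫⁻ X, (min (F X) (G X) : ℝ≥0) ∂(Measure.pi fun _ : Fin n => μ) := by
    have h1 : (6 : ℝ≥0∞) * ∫⁻ X, NNReal.sqrt (F X * G X) ∂(Measure.pi fun _ : Fin n => μ) ≤
        8 * ∫⁻ X, (min (F X) (G X) : ℝ≥0) ∂(Measure.pi fun _ : Fin n => μ) + 2 := by
      have h2 : (2 : ℝ≥0∞) = ∫⁻ X, F X ∂(Measure.pi fun _ : Fin n => μ) +
          ∫⁻ X, G X ∂(Measure.pi fun _ : Fin n => μ) := by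
        rw [hprod f hf, hprod g hg, hf1, hg1, one_pow, one_add_one_eq_two]
      have hm := (hF.min hG).coe_nnreal_ennreal
      rw [h2, ← lintegral_const_mul' _ _ (by simp), ← lintegral_const_mul' _ _ (by simp),
        ← lintegral_add_left hF.coe_nnreal_ennreal, ← lintegral_add_left (hm.const_mul _)]
      refine lintegral_mono fun X => ?_
      have h := ENNReal.coe_le_coe.2 (six_mul_sqrt_mul_le (F X) (G X))
      push_cast at h ⊢
      exact h
    have h3 : ∀ X : Fin n → α, NNReal.sqrt (F X * G X) = ∏ i, NNReal.sqrt (f (X i) * g (X i)) :=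
      fun X => by
        rw [← Finset.prod_mul_distrib]
        exact map_prod NNReal.sqrtHom _ _
    simp_rw [h3] at h1
    rw [hprod (fun x => NNReal.sqrt (f x * g x))
      (NNReal.continuous_sqrt.measurable.comp (hf.mul hg))] at h1
    -- Affinity at least `1/2` makes the left side of `h1` at least 3; removing the total mass 2
    -- leaves 1.
    have h4 : (3 : ℝ≥0∞) ≤ 6 * (∫⁻ x, NNReal.sqrt (f x * g x) ∂μ) ^ n := by
      calc (3 : ℝ≥0∞) = 3 * 1 := by norm_num
        _ ≤ 3 * (2 * (∫⁻ x, NNReal.sqrt (f x * g x) ∂μ) ^ n) := by gcongr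
        _ = _ := by rw [← mul_assoc]; norm_num
    have h5 := h4.trans h1
    rw [show (3 : ℝ≥0∞) = 1 + 2 by norm_num] at h5
    exact (ENNReal.add_le_add_iff_right (by simp)).1 h5
  have hfin : ∀ h : α → ℝ≥0, ∫⁻ x, h x ∂μ = 1 →
      SigmaFinite (μ.withDensity fun x => (h x : ℝ≥0∞)) := fun h hh => by
    have := isFiniteMeasure_withDensity (μ := μ) (f := fun x => (h x : ℝ≥0∞)) (by simp [hh])
    infer_instance
  have := hfin f hf1
  have := hfin g hg1
  rw [pi_withDensity hfm, pi_withDensity hgm]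
  simp_rw [← ENNReal.ofNNReal_finsetProd]
  have hF' : Measurable fun X => (F X : ℝ≥0∞) := hF.coe_nnreal_ennreal
  have hG' : Measurable fun X => (G X : ℝ≥0∞) := hG.coe_nnreal_ennreal
  rw [lintegral_withDensity_eq_lintegral_mul _ hF' hH,
    lintegral_withDensity_eq_lintegral_mul _ hG' hK, ← lintegral_add_left (hF'.mul hH)]
  calc b = b * 1 := (mul_one b).symm
    _ ≤ b * (8 * ∫⁻ X, (min (F X) (G X) : ℝ≥0) ∂(Measure.pi fun _ : Fin n => μ)) := by gcongr
    _ = 8 * ∫⁻ X, b * (min (F X) (G X) : ℝ≥0) ∂(Measure.pi fun _ : Fin n => μ) := by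
      rw [lintegral_const_mul _ (hF.min hG).coe_nnreal_ennreal]; ring
    _ ≤ _ := by
      gcongr with X
      calc b * (min (F X) (G X) : ℝ≥0) ≤ (H X + K X) * (min (F X) (G X) : ℝ≥0) := by
            gcongr; exact hb X
        _ = (min (F X) (G X) : ℝ≥0) * H X + (min (F X) (G X) : ℝ≥0) * K X := by ring
        _ ≤ F X * H X + G X * K X := by
          gcongr
          · exact min_le_left _ _
          · exact min_le_right _ _

/-- The elementary inequality `‖u - v‖² ≤ 2 (‖t - u‖² + ‖t - v‖²)` in `ℝ≥0∞`. -/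
theorem enorm_sub_sq_le (t u v : ℝ) :
    ‖u - v‖ₑ ^ 2 ≤ 2 * (‖t - u‖ₑ ^ 2 + ‖t - v‖ₑ ^ 2) := by
  simp only [← ofReal_norm, Real.norm_eq_abs]
  rw [← ENNReal.ofReal_pow (abs_nonneg _), ← ENNReal.ofReal_pow (abs_nonneg _),
    ← ENNReal.ofReal_pow (abs_nonneg _), ← ENNReal.ofReal_add (by positivity) (by positivity),
    show (2 : ℝ≥0∞) = ENNReal.ofReal 2 by simp, ← ENNReal.ofReal_mul (by norm_num)]
  refine ENNReal.ofReal_le_ofReal ?_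
  simp only [sq_abs]
  nlinarith [sq_nonneg ((t - u) + (t - v))]

/-! ### Assouad's lemma. -/

/-- The hypercube vertex obtained from `σ` by switching the coordinate `j`. -/
def toggle {N : ℕ} (j : Fin N) (σ : Fin N → Bool) : Fin N → Bool :=
  Function.update σ j (!σ j)

theorem toggle_involutive {N : ℕ} (j : Fin N) : Function.Involutive (toggle j) := fun σ => by
  simp  [toggle]

theorem sum_add_toggle {N : ℕ} (j : Fin N) (R : (Fin N → Bool) → ℝ≥0∞) :
    ∑ σ, (R σ + R (toggle j σ)) = 2 * ∑ σ, R σ := by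
  rw [Finset.sum_add_distrib, two_mul]
  congr 1
  exact Equiv.sum_comp (toggle_involutive j).toPerm R

/-- Averaging over the hypercube, coordinate by coordinate. -/
theorem exists_hypercube_le {N : ℕ} (R : (Fin N → Bool) → ℝ≥0∞)
    (S : Fin N → (Fin N → Bool) → ℝ≥0∞) (hS : ∀ σ, ∑ j, S j σ ≤ R σ) {b : ℝ≥0∞}
    (hb : ∀ j σ, b ≤ S j σ + S j (toggle j σ)) : ∃ σ, N * b ≤ 2 * R σ := by
  have h : ∑ _σ : Fin N → Bool, N * b ≤ ∑ σ : Fin N → Bool, 2 * R σ :=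
    calc ∑ _σ : Fin N → Bool, N * b = ∑ j : Fin N, ∑ σ : Fin N → Bool, b := by
          rw [Finset.sum_comm]; simp
      _ ≤ ∑ j, ∑ σ, (S j σ + S j (toggle j σ)) :=
          Finset.sum_le_sum fun j _ => Finset.sum_le_sum fun σ _ => hb j σ
      _ = ∑ j, 2 * ∑ σ, S j σ := by simp_rw [sum_add_toggle]
      _ = ∑ σ, 2 * ∑ j, S j σ := by
          rw [← Finset.mul_sum, Finset.sum_comm, Finset.mul_sum]
      _ ≤ _ := by gcongr with σ; exact hS σ
  by_contra! hlt
  exact h.not_gt (ENNReal.sum_lt_sum_of_nonempty Finset.univ_nonempty fun σ _ => hlt σ)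

theorem sqDist_eq_lintegral {d : ℕ} (f g : EuclideanSpace ℝ (Fin d) → ℝ) :
    sqDist f g = ∫⁻ x, ‖f x - g x‖ₑ ^ 2 := by
  have := eLpNorm_nnreal_pow_eq_lintegral (f := fun x => f x - g x) (μ := volume) (p := 2)
    two_ne_zero
  simpa [sqDist] using this

/-- Assouad's lemma for densities that differ from cell to cell. -/
theorem exists_risk_ge {d n N : ℕ} (q : (Fin N → Bool) → EuclideanSpace ℝ (Fin d) → ℝ)
    (hqm : ∀ σ, Measurable (q σ)) (hq1 : ∀ σ, ∫⁻ x, ENNReal.ofReal (q σ x) = 1)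
    (B : Fin N → Set (EuclideanSpace ℝ (Fin d))) (hBm : ∀ j, MeasurableSet (B j))
    (hBd : Pairwise (Function.onFun Disjoint B)) {e : ℝ≥0∞}
    (he : ∀ j σ, e ≤ ∫⁻ x in B j, ‖q σ x - q (toggle j σ) x‖ₑ ^ 2)
    (haff : ∀ j σ, 1 ≤ 2 * (∫⁻ x, NNReal.sqrt ((q σ x).toNNReal * (q (toggle j σ) x).toNNReal)) ^ n)
    {T : (Fin n → EuclideanSpace ℝ (Fin d)) → EuclideanSpace ℝ (Fin d) → ℝ}
    (hT : Measurable (Function.uncurry T)) :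
    ∃ σ, N * e ≤ 32 * risk T (q σ) := by
  let D : Fin N → (Fin N → Bool) → (Fin n → EuclideanSpace ℝ (Fin d)) → ℝ≥0∞ :=
    fun j σ X => ∫⁻ x in B j, ‖T X x - q σ x‖ₑ ^ 2
  have hint : ∀ σ, Measurable fun z : (Fin n → EuclideanSpace ℝ (Fin d)) ×
      EuclideanSpace ℝ (Fin d) => ‖T z.1 z.2 - q σ z.2‖ₑ ^ 2 := fun σ =>
    ((hT.sub ((hqm σ).comp measurable_snd)).enorm).pow_const 2
  have hDm : ∀ j σ, Measurable (D j σ) := fun j σ => (hint σ).lintegral_prod_right'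
  have hD : ∀ j σ X, e ≤ 2 * (D j σ X + D j (toggle j σ) X) := fun j σ X => by
    have hm : Measurable fun x => ‖T X x - q σ x‖ₑ ^ 2 := (hint σ).comp measurable_prodMk_left
    refine (he j σ).trans ?_
    rw [← lintegral_add_left hm, ← lintegral_const_mul' _ _ (by simp)]
    exact lintegral_mono fun x => enorm_sub_sq_le _ _ _
  -- The factor 16 is 2 from `enorm_sub_sq_le` times 8 from `two_point_bound`; averaging over the
  -- hypercube doubles it to 32. Disjointness of the sets `B j` lets the local losses add up to at
  -- most the full loss.
  obtain ⟨σ, hσ⟩ := exists_hypercube_le (fun σ => 16 * risk T (q σ))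
    (fun j σ => 16 * ∫⁻ X, D j σ X ∂(sampleLaw n (q σ))) (fun σ => by
      rw [← Finset.mul_sum, ← lintegral_finsetSum _ fun j _ => hDm j σ]
      gcongr
      refine lintegral_mono fun X => ?_
      rw [sqDist_eq_lintegral, ← tsum_fintype (L := .unconditional _),
        ← lintegral_iUnion hBm hBd]
      exact setLIntegral_le_lintegral _ _) (b := e) (fun j σ => by
      have h := two_point_bound (μ := (volume : Measure (EuclideanSpace ℝ (Fin d))))
        (hqm σ).real_toNNReal (hqm (toggle j σ)).real_toNNReal
        (hq1 σ) (hq1 _) (haff j σ) ((hDm j σ).const_mul 2) ((hDm j (toggle j σ)).const_mul 2)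
        (fun X => (hD j σ X).trans_eq (mul_add _ _ _))
      rw [lintegral_const_mul _ (hDm j σ), lintegral_const_mul _ (hDm j _)] at h
      refine h.trans_eq ?_
      rw [← mul_add, ← mul_add, ← mul_assoc]
      norm_num
      rfl)
  refine ⟨σ, hσ.trans_eq ?_⟩
  rw [← mul_assoc]
  norm_num

/-! ### Step functions on disjoint cells. -/

section StepFunctions

variable {d : ℕ} {κ : Type*} [Fintype κ]

/-- The step function with the value `c k` on the cell `E k`. -/
noncomputable def stepFun (E : κ → Set (EuclideanSpace ℝ (Fin d))) (c : κ → ℝ) :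
    EuclideanSpace ℝ (Fin d) → ℝ :=
  fun x => ∑ k, (E k).indicator (fun _ => c k) x

variable {E : κ → Set (EuclideanSpace ℝ (Fin d))}

theorem stepFun_of_mem (hd : Pairwise (Function.onFun Disjoint E)) (c : κ → ℝ) {k : κ}
    {x : EuclideanSpace ℝ (Fin d)} (hx : x ∈ E k) : stepFun E c x = c k := by
  rw [stepFun, Finset.sum_eq_single k, Set.indicator_of_mem hx]
  · intro l _ hl
    exact Set.indicator_of_notMem (fun h => Set.disjoint_left.1 (hd hl) h hx) _
  · simp

theorem stepFun_of_forall_notMem (c : κ → ℝ) {x : EuclideanSpace ℝ (Fin d)}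
    (hx : ∀ k, x ∉ E k) : stepFun E c x = 0 :=
  Finset.sum_eq_zero fun k _ => Set.indicator_of_notMem (hx k) _

theorem stepFun_mem_Icc (hd : Pairwise (Function.onFun Disjoint E)) {c : κ → ℝ} {L : ℝ}
    (hL : 0 ≤ L) (hc : ∀ k, c k ∈ Set.Icc 0 L) (x : EuclideanSpace ℝ (Fin d)) :
    stepFun E c x ∈ Set.Icc 0 L := by
  by_cases h : ∃ k, x ∈ E k
  · obtain ⟨k, hk⟩ := h
    rw [stepFun_of_mem hd c hk]
    exact hc k
  · rw [stepFun_of_forall_notMem c (by simpa using h)]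
    exact ⟨le_rfl, hL⟩

theorem measurable_stepFun (hE : ∀ k, MeasurableSet (E k)) (c : κ → ℝ) :
    Measurable (stepFun E c) :=
  Finset.measurable_fun_sum _ fun k _ => measurable_const.indicator (hE k)

theorem memLp_stepFun (hE : ∀ k, MeasurableSet (E k)) (hv : ∀ k, volume (E k) ≠ ∞) (c : κ → ℝ)
    (p : ℝ≥0∞) : MemLp (stepFun E c) p volume :=
  memLp_finsetSum _ fun k _ => memLp_indicator_const p (hE k) (c k) (Or.inr (hv k))

theorem integral_stepFun (hE : ∀ k, MeasurableSet (E k)) (hv : ∀ k, volume (E k) ≠ ∞)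
    (c : κ → ℝ) : ∫ x, stepFun E c x = ∑ k, volume.real (E k) * c k := by
  have h : ∀ k, Integrable ((E k).indicator fun _ => c k) volume := fun k =>
    (integrable_indicator_iff (hE k)).2 (integrableOn_const (hv k))
  simp only [stepFun]
  rw [integral_finsetSum _ fun k _ => h k]
  exact Finset.sum_congr rfl fun k _ => by rw [integral_indicator_const _ (hE k), smul_eq_mul]

theorem combination_stepFun {M : ℕ} (c : Fin M → κ → ℝ) (w : Fin M → ℝ) :
    combination (fun j => stepFun E (c j)) w = stepFun E fun k => ∑ j, w j * c j k := by
  ext x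
  simp only [combination, stepFun, Finset.mul_sum]
  rw [Finset.sum_comm]
  refine Finset.sum_congr rfl fun k _ => ?_
  by_cases hx : x ∈ E k <;> simp [hx]

end StepFunctions

/-! ### Perturbations and the affinity of neighbouring vertices. -/

section Hypercube

variable {N : ℕ}

/-- The relative perturbation on the two halves of each cell that is switched on by `σ`. -/
noncomputable def perturbation (δ : ℝ) (σ : Fin N → Bool) (k : Fin N × Bool) : ℝ :=
  if σ k.1 then (if k.2 then δ else -δ) else 0

theorem perturbation_toggle_of_ne (δ : ℝ) (σ : Fin N → Bool) {j : Fin N} {k : Fin N × Bool}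
    (hk : k.1 ≠ j) : perturbation δ (toggle j σ) k = perturbation δ σ k := by
  simp [perturbation, toggle, Function.update_of_ne hk]

theorem perturbation_toggle_self (δ : ℝ) (σ : Fin N → Bool) (j : Fin N) (b : Bool) :
    perturbation δ (toggle j σ) (j, b) = (if b then δ else -δ) - perturbation δ σ (j, b) := by
  cases h : σ j <;> simp [perturbation, toggle, h]

theorem abs_perturbation_le {δ : ℝ} (hδ : 0 ≤ δ) (σ : Fin N → Bool) (k : Fin N × Bool) :
    |perturbation δ σ k| ≤ δ := by
  unfold perturbation
  split_ifs <;> simp [abs_of_nonneg hδ, hδ]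

/-- The two halves of a block cancel. This normalizes the densities and removes the first-order
terms from the affinity. -/
theorem sum_perturbation (δ : ℝ) (σ : Fin N → Bool) : ∑ k, perturbation δ σ k = 0 := by
  rw [Fintype.sum_prod_type]
  refine Finset.sum_eq_zero fun j _ => ?_
  cases h : σ j <;> simp [perturbation, h]

theorem sq_perturbation_sub_toggle (δ : ℝ) (σ : Fin N → Bool) (j : Fin N) (b : Bool) :
    (perturbation δ σ (j, b) - perturbation δ (toggle j σ) (j, b)) ^ 2 = δ ^ 2 := by
  rw [perturbation_toggle_self]
  cases h : σ j <;> cases b <;> simp [perturbation, h]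

/-- The left side is `(1 + t)(1 - t / 2)`, and `(1 + t)(1 - t / 2)² = 1 - t² (3 - t) / 4 ≤ 1`. The
point `t = -1` forces the quadratic coefficient `1/2`. -/
theorem le_sqrt_one_add {t : ℝ} (ht : |t| ≤ 1) : 1 + t / 2 - t ^ 2 / 2 ≤ √(1 + t) := by
  obtain ⟨h1, h2⟩ := abs_le.1 ht
  refine Real.le_sqrt_of_sq_le ?_
  nlinarith [mul_nonneg (sq_nonneg t) (sub_nonneg.2 h2),
    mul_nonneg (sq_nonneg t) (by linarith : 0 ≤ 1 + t), sq_nonneg t]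

/-- In block `j` one of the two perturbations is 0 and the other `±δ`, so `le_sqrt_one_add` applies;
elsewhere they agree and equality holds. The linear term is kept because it cancels in the sum. -/
theorem le_sqrt_perturbation_toggle {δ : ℝ} (hδ : 0 ≤ δ) (hδ1 : δ ≤ 1) (σ : Fin N → Bool)
    (j : Fin N) (k : Fin N × Bool) :
    1 + (perturbation δ σ k + perturbation δ (toggle j σ) k) / 2 -
        (if k.1 = j then δ ^ 2 / 2 else 0) ≤
      √((1 + perturbation δ σ k) * (1 + perturbation δ (toggle j σ) k)) := by
  by_cases hk : k.1 = j
  · obtain ⟨i, b⟩ := k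
    obtain rfl : i = j := hk
    have h1 := le_sqrt_one_add (t := δ) (by rwa [abs_of_nonneg hδ])
    have h2 := le_sqrt_one_add (t := -δ) (by rwa [abs_neg, abs_of_nonneg hδ])
    rw [perturbation_toggle_self]
    cases h : σ i <;> cases b <;> simp [perturbation, h] <;> simp at h1 h2 <;> linarith
  · have h0 := abs_le.1 (abs_perturbation_le hδ σ k)
    rw [perturbation_toggle_of_ne δ σ hk, if_neg hk, Real.sqrt_mul_self (by linarith)]
    linarith

/-- Only the two cells of block `j` lose anything, `δ² / 2` each. -/
theorem sum_sqrt_perturbation_ge {δ : ℝ} (hδ : 0 ≤ δ) (hδ1 : δ ≤ 1) (σ : Fin N → Bool)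
    (j : Fin N) :
    2 * N - δ ^ 2 ≤
      ∑ k, √((1 + perturbation δ σ k) * (1 + perturbation δ (toggle j σ) k)) := by
  refine le_trans (le_of_eq ?_)
    (Finset.sum_le_sum fun k _ => le_sqrt_perturbation_toggle hδ hδ1 σ j k)
  rw [Finset.sum_sub_distrib, Finset.sum_add_distrib, ← Finset.sum_div, Finset.sum_add_distrib,
    sum_perturbation, sum_perturbation, Fintype.sum_prod_type]
  rw [Fintype.sum_prod_type]
  simp
  rw [Finset.sum_add_distrib]
  simp
  ring

end Hypercube

/-! ### Construction of the cells. -/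

section Cells

/-- Disjoint slabs of a prescribed volume. -/
theorem exists_disjoint_cells {d : ℕ} (hd : 1 ≤ d) {v : ℝ} (hv : 0 < v) :
    ∃ E : ℕ → Set (EuclideanSpace ℝ (Fin d)), (∀ k, MeasurableSet (E k)) ∧
      Pairwise (Function.onFun Disjoint E) ∧ ∀ k, volume (E k) = ENNReal.ofReal v := by
  let i₀ : Fin d := ⟨0, hd⟩
  -- Slab `k` is `[kv, (k + 1)v)` in the first coordinate and `[0, 1)` in the others.
  let lo : ℕ → Fin d → ℝ := fun k => Function.update 0 i₀ (k * v)
  let hi : ℕ → Fin d → ℝ := fun k => Function.update 1 i₀ ((k + 1) * v)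
  have hm : ∀ k, MeasurableSet (Set.univ.pi fun i => Set.Ico (lo k i) (hi k i)) := fun k =>
    MeasurableSet.univ_pi fun i => measurableSet_Ico
  have hmp := PiLp.volume_preserving_ofLp (Fin d)
  refine ⟨fun k => WithLp.ofLp ⁻¹' Set.univ.pi fun i => Set.Ico (lo k i) (hi k i),
    fun k => hmp.measurable (hm k), fun k l hkl => ?_, fun k => ?_⟩
  · refine Disjoint.preimage _ (Set.disjoint_left.2 fun x hx hy => hkl ?_)
    have h1 := hx i₀ trivial
    have h2 := hy i₀ trivial
    simp only [lo, hi, Function.update_self, Set.mem_Ico] at h1 h2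
    have h3 : (k : ℝ) < l + 1 := lt_of_mul_lt_mul_right (h1.1.trans_lt h2.2) hv.le
    have h4 : (l : ℝ) < k + 1 := lt_of_mul_lt_mul_right (h2.1.trans_lt h1.2) hv.le
    norm_cast at h3 h4
    omega
  · rw [hmp.measure_preimage (hm k).nullMeasurableSet, Real.volume_pi_Ico,
      Finset.prod_eq_single i₀]
    · simp only [lo, hi, Function.update_self]
      congr 1
      ring
    · intro i _ hi'
      simp [lo, hi, Function.update_of_ne hi']
    · simp

end Cells

/-! ### The hypercube of densities and its dictionary. -/

/-- The values, on the cells, of the density attached to the hypercube vertex `σ`. -/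
noncomputable def vertexValue {N : ℕ} (a δ : ℝ) (σ : Fin N → Bool) (k : Fin N × Bool) : ℝ :=
  a * (1 + perturbation δ σ k)

theorem sqrt_vertexValue_mul {N : ℕ} {a : ℝ} (ha : 0 ≤ a) (δ : ℝ) (σ τ : Fin N → Bool)
    (k : Fin N × Bool) : √(vertexValue a δ σ k * vertexValue a δ τ k) =
      a * √((1 + perturbation δ σ k) * (1 + perturbation δ τ k)) := by
  rw [vertexValue, vertexValue, mul_mul_mul_comm, Real.sqrt_mul (mul_self_nonneg a),
    Real.sqrt_mul_self ha]

/-- The values, on the cells, of the dictionary: the base function and `N` perturbations. -/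
noncomputable def dictionaryValue {N : ℕ} (a δ : ℝ) :
    Fin (N + 1) → Fin N × Bool → ℝ :=
  Fin.cons (fun _ => 2 * a)
    fun j k => if k.1 = j then 2 * N * a * (if k.2 then δ else -δ) else 0

/-- Every vertex of the hypercube is a combination of the dictionary with weights in the
simplex. -/
theorem exists_weights_eq_vertexValue {N : ℕ} (a δ : ℝ) (σ : Fin N → Bool) :
    ∃ w ∈ weightSimplex (N + 1), ∀ k : Fin N × Bool,
      ∑ j, w j * dictionaryValue a δ j k = vertexValue a δ σ k := by
  -- Half of the weight goes to the base function, the other half is shared equally by the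
  -- perturbations; the factors `2` and `2 * N` in the dictionary undo this.
  refine ⟨Fin.cons (1 / 2) fun j => if σ j then 1 / (2 * N) else 0, ⟨fun j => ?_, ?_⟩,
    fun k => ?_⟩
  · refine Fin.cases (by simp) (fun j => ?_) j
    rw [Fin.cons_succ]
    split_ifs <;> positivity
  · rw [Fin.sum_univ_succ]
    simp only [Fin.cons_zero, Fin.cons_succ]
    have h : ∑ j : Fin N, (if σ j then 1 / (2 * N : ℝ) else 0) ≤ ∑ _j : Fin N, 1 / (2 * N : ℝ) :=
      Finset.sum_le_sum fun j _ => by split_ifs <;> first | exact le_rfl | positivity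
    have h' : ∑ _j : Fin N, 1 / (2 * N : ℝ) ≤ 1 / 2 := by
      rcases Nat.eq_zero_or_pos N with rfl | hN
      · simp
      · have : (0 : ℝ) < N := by exact_mod_cast hN
        rw [Finset.sum_const, Finset.card_univ, Fintype.card_fin, nsmul_eq_mul]
        apply le_of_eq
        field_simp
    linarith
  · have hN : (N : ℝ) ≠ 0 := by exact_mod_cast (Fin.pos k.1).ne'
    rw [Fin.sum_univ_succ]
    simp only [dictionaryValue, Fin.cons_zero, Fin.cons_succ, mul_ite, mul_zero,
      Finset.sum_ite_eq, Finset.mem_univ, if_true, vertexValue, perturbation]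
    cases σ k.1 <;> cases k.2 <;> simp <;> field_simp

/-- The excess risk of every estimator on the hypercube of densities of height about `a` and
relative perturbation `δ`. -/
theorem exists_dictionary {d n N : ℕ} (hN : 0 < N) {a v δ : ℝ} (ha : 0 < a) (hv : 0 < v)
    (hav : 2 * N * v * a = 1) (hδ : 0 ≤ δ) (hδ1 : δ ≤ 1) (hn : n * δ ^ 2 ≤ N)
    {E : Fin N × Bool → Set (EuclideanSpace ℝ (Fin d))} (hE : ∀ k, MeasurableSet (E k))
    (hd : Pairwise (Function.onFun Disjoint E)) (hEv : ∀ k, volume (E k) = ENNReal.ofReal v) :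
    ∃ p : Fin (N + 1) → EuclideanSpace ℝ (Fin d) → ℝ, (∀ j, MemLp (p j) 2 volume) ∧
      ∀ T ∈ estimators d n, ∃ q ∈ boundedDensities d (2 * a),
        (⨅ w ∈ weightSimplex (N + 1), sqDist (combination p w) q) = 0 ∧
        ENNReal.ofReal (a * δ ^ 2) ≤ 32 * risk T q := by
  have hfin : ∀ k, volume (E k) ≠ ∞ := fun k => by rw [hEv]; exact ENNReal.ofReal_ne_top
  have hN' : (0 : ℝ) < N := by exact_mod_cast hN
  let q : (Fin N → Bool) → EuclideanSpace ℝ (Fin d) → ℝ := fun σ => stepFun E (vertexValue a δ σ)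
  have hrange : ∀ (σ : Fin N → Bool) (k : Fin N × Bool), vertexValue a δ σ k ∈ Set.Icc 0 (2 * a) := fun σ k => by
    obtain ⟨h1, h2⟩ := abs_le.1 (abs_perturbation_le hδ σ k)
    constructor <;> unfold vertexValue <;> nlinarith
  have hqIcc : ∀ σ x, q σ x ∈ Set.Icc 0 (2 * a) := fun σ =>
    stepFun_mem_Icc hd (by positivity) (hrange σ)
  have hqm : ∀ σ, Measurable (q σ) := fun σ => measurable_stepFun hE _
  have hqi : ∀ σ, Integrable (q σ) volume := fun σ =>
    memLp_one_iff_integrable.1 (memLp_stepFun hE hfin _ 1)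
  have hq1 : ∀ σ, ∫ x, q σ x = 1 := fun σ => by
    have hr : ∀ k, volume.real (E k) = v := fun k => by
      rw [measureReal_def, hEv, ENNReal.toReal_ofReal hv.le]
    simp only [q]
    rw [integral_stepFun hE hfin]
    simp only [hr, vertexValue]
    rw [← Finset.mul_sum, ← Finset.mul_sum, Finset.sum_add_distrib, sum_perturbation]
    simp
    linarith
  have hqmem : ∀ σ, q σ ∈ boundedDensities d (2 * a) := fun σ => by
    refine ⟨fun x => (hqIcc σ x).1, hqi σ, hq1 σ, ?_⟩
    rw [eLpNorm_exponent_top]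
    refine eLpNormEssSup_le_of_ae_bound (.of_forall fun x => ?_)
    rw [Real.norm_of_nonneg (hqIcc σ x).1]
    exact (hqIcc σ x).2
  refine ⟨fun j => stepFun E (dictionaryValue a δ j), fun j => memLp_stepFun hE hfin _ 2,
    fun T hT => ?_⟩
  have key := exists_risk_ge (n := n) q hqm
    (fun σ => by
      rw [← ofReal_integral_eq_lintegral_ofReal (hqi σ)
        (.of_forall fun x => (hqIcc σ x).1), hq1, ENNReal.ofReal_one])
    (fun j => E (j, true) ∪ E (j, false)) (fun j => (hE _).union (hE _))
    (fun i j hij => by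
      have h : ∀ b b', Disjoint (E (i, b)) (E (j, b')) := fun b b' =>
        hd fun h => hij (congrArg Prod.fst h)
      simp only [Function.onFun, Set.disjoint_union_left, Set.disjoint_union_right]
      exact ⟨⟨h _ _, h _ _⟩, h _ _, h _ _⟩)
    -- Two cells of volume `v`, on each of which neighbours differ by `a δ`. By `hav`, `N` times
    -- this is `a δ²`.
    (e := ENNReal.ofReal (2 * (a * δ) ^ 2 * v))
    (fun j σ => by
      have hcell : ∀ b, ∫⁻ x in E (j, b), ‖q σ x - q (toggle j σ) x‖ₑ ^ 2 =
          ENNReal.ofReal ((a * δ) ^ 2 * v) := fun b => by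
        rw [setLIntegral_congr_fun (g := fun _ => ENNReal.ofReal ((a * δ) ^ 2)) (hE _),
          setLIntegral_const, hEv, ENNReal.ofReal_mul (by positivity)]
        intro x hx
        simp only [q]
        rw [stepFun_of_mem hd _ hx, stepFun_of_mem hd _ hx, ← ofReal_norm,
          ← ENNReal.ofReal_pow (norm_nonneg _), Real.norm_eq_abs, sq_abs, mul_pow,
          ← sq_perturbation_sub_toggle δ σ j b, vertexValue, vertexValue]
        congr 1
        ring
      rw [lintegral_union (hE _) (hd (by simp)), hcell, hcell,
        ← ENNReal.ofReal_add (by positivity) (by positivity)]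
      exact ENNReal.ofReal_le_ofReal (by linarith))
    (fun j σ => by
      have hcell : ∀ k, ENNReal.ofReal (v * a *
          √((1 + perturbation δ σ k) * (1 + perturbation δ (toggle j σ) k))) =
          ∫⁻ x in E k, NNReal.sqrt ((q σ x).toNNReal * (q (toggle j σ) x).toNNReal) := fun k => by
        rw [setLIntegral_congr_fun (g := fun _ => ENNReal.ofReal (a *
            √((1 + perturbation δ σ k) * (1 + perturbation δ (toggle j σ) k)))) (hE _),
          setLIntegral_const, hEv, ← ENNReal.ofReal_mul (by positivity)]
        · congr 1
          ring
        · intro x hx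
          simp only [q]
          rw [stepFun_of_mem hd _ hx, stepFun_of_mem hd _ hx,
            ← Real.toNNReal_mul (hrange _ _).1, ENNReal.ofReal, ENNReal.coe_inj]
          rw [← sqrt_vertexValue_mul ha.le, Real.sqrt, Real.toNNReal_coe]
      have hsum : ENNReal.ofReal (1 - δ ^ 2 / (2 * N)) ≤
          ∫⁻ x, NNReal.sqrt ((q σ x).toNNReal * (q (toggle j σ) x).toNNReal) := by
        refine le_trans ?_ (setLIntegral_le_lintegral (⋃ k, E k) _)
        rw [lintegral_iUnion hE hd, tsum_fintype]
        simp_rw [← hcell]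
        rw [← ENNReal.ofReal_sum_of_nonneg fun k _ => by positivity, ← Finset.mul_sum]
        refine ENNReal.ofReal_le_ofReal ?_
        have hva : v * a = 1 / (2 * N) := by field_simp; linarith
        calc 1 - δ ^ 2 / (2 * N) = v * a * (2 * N - δ ^ 2) := by rw [hva]; field_simp
          _ ≤ _ := mul_le_mul_of_nonneg_left (sum_sqrt_perturbation_ge hδ hδ1 σ j)
            (by positivity)
      have hN1 : (1 : ℝ) ≤ N := by exact_mod_cast hN
      have hδN : δ ^ 2 / (2 * N) ≤ 1 := by
        rw [div_le_one (by positivity)]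
        nlinarith
      -- Bernoulli's inequality, where `n δ² ≤ N` keeps the loss at most `1/2`.
      have hbern : (1 : ℝ) / 2 ≤ (1 - δ ^ 2 / (2 * N)) ^ n := by
        have h := one_add_mul_le_pow (a := -(δ ^ 2 / (2 * N))) (by linarith) n
        rw [← sub_eq_add_neg] at h
        refine le_trans ?_ h
        have : n * (δ ^ 2 / (2 * N)) ≤ 1 / 2 := by
          rw [mul_div_assoc', div_le_iff₀ (by positivity)]
          linarith
        linarith
      calc (1 : ℝ≥0∞) = 2 * ENNReal.ofReal (1 / 2) := by
            rw [show (2 : ℝ≥0∞) = ENNReal.ofReal 2 by simp, ← ENNReal.ofReal_mul (by norm_num)]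
            norm_num
        _ ≤ 2 * ENNReal.ofReal ((1 - δ ^ 2 / (2 * N)) ^ n) := by
            gcongr
        _ ≤ _ := by
            rw [ENNReal.ofReal_pow (by linarith)]
            gcongr)
    (T := T) hT
  obtain ⟨σ, hσ⟩ := key
  refine ⟨q σ, hqmem σ, ?_, ?_⟩
  · obtain ⟨w, hw, hwk⟩ := exists_weights_eq_vertexValue a δ σ
    refine le_antisymm (iInf₂_le_of_le w hw (le_of_eq ?_)) zero_le
    rw [combination_stepFun, funext hwk]
    simp [sqDist, q]
  · refine le_trans (le_of_eq ?_) hσ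
    rw [← ENNReal.ofReal_natCast, ← ENNReal.ofReal_mul (by positivity)]
    congr 1
    calc a * δ ^ 2 = (2 * N * v * a) * (a * δ ^ 2) := by rw [hav, one_mul]
      _ = _ := by ring

end DensityAggregation

/-! ### Choice of the parameters. -/

open DensityAggregation in
theorem theorem3p2 (c₀ : ℝ) (hc₀ : 0 < c₀) :
    ∃ c : ℝ, 0 < c ∧
      ∀ (d : ℕ), 1 ≤ d → ∀ (L : ℝ), 0 < L →
      ∀ (M n : ℕ), 2 ≤ M → 1 ≤ n → (M : ℝ) ≤ c₀ * (n : ℝ) →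
      ∃ p : Fin M → EuclideanSpace ℝ (Fin d) → ℝ,
        (∀ j, MemLp (p j) 2 volume) ∧
        ((c * L * (M : ℝ) / (n : ℝ) : ℝ) : EReal) ≤
          ⨅ T ∈ DensityAggregation.estimators d n,
            ⨆ q ∈ DensityAggregation.boundedDensities d L,
              DensityAggregation.excessRisk (DensityAggregation.weightSimplex M) p T q := by
  have hc1 : 0 < min 1 (1 / c₀) := lt_min one_pos (by positivity)
  refine ⟨min 1 (1 / c₀) / 128, by positivity, fun d hd L hL M n hM hn hMn => ?_⟩
  obtain ⟨N, rfl⟩ : ∃ N, M = N + 1 := ⟨M - 1, by omega⟩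
  have hN : 0 < N := by omega
  have hN1 : (1 : ℝ) ≤ N := by exact_mod_cast hN
  have hn1 : (1 : ℝ) ≤ n := by exact_mod_cast hn
  push_cast at hMn ⊢
  have hm1 : min 1 (1 / c₀) ≤ 1 := min_le_left _ _
  have hmc : min 1 (1 / c₀) * c₀ ≤ 1 := by
    rw [← le_div_iff₀ hc₀]
    exact min_le_right _ _
  set m := min 1 (1 / c₀)
  have hδsq : √(m * N / n) ^ 2 = m * N / n := Real.sq_sqrt (by positivity)
  -- `m c₀ ≤ 1` gives `m N ≤ m c₀ n ≤ n`; the other bound `m ≤ 1` is what yields `n δ² ≤ N` below.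
  have hδ1 : √(m * N / n) ≤ 1 := by
    rw [Real.sqrt_le_one, div_le_one (by positivity)]
    nlinarith [mul_le_mul_of_nonneg_left hMn hc1.le]
  -- The volume makes `2N` cells of height `L / 2` carry mass 1.
  obtain ⟨E, hEm, hEd, hEv⟩ := exists_disjoint_cells hd (v := 1 / (L * N)) (by positivity)
  obtain ⟨p, hp, hpT⟩ := exists_dictionary (n := n) hN (a := L / 2) (v := 1 / (L * N))
    (δ := √(m * N / n)) (by positivity) (by positivity) (by field_simp) (Real.sqrt_nonneg _)
    hδ1 (by
      rw [hδsq, mul_div_cancel₀ _ (by positivity)]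
      nlinarith)
    (E := fun k => E (Encodable.encode k)) (fun k => hEm _)
    (fun k l hkl => hEd fun h => hkl (Encodable.encode_injective h)) (fun k => hEv _)
  refine ⟨p, hp, le_iInf₂ fun T hT => ?_⟩
  obtain ⟨q, hq, hinf, hrisk⟩ := hpT T hT
  rw [mul_div_cancel₀ L two_ne_zero] at hq
  refine le_iSup₂_of_le q hq ?_
  rw [excessRisk, hinf, EReal.coe_ennreal_zero, sub_zero]
  have h1 : ENNReal.ofReal (m / 128 * L * (N + 1) / n) ≤ risk T q := by
    have h2 : (32 : ℝ≥0∞) * ENNReal.ofReal (m / 128 * L * (N + 1) / n) ≤ 32 * risk T q := by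
      refine le_trans ?_ hrisk
      rw [show (32 : ℝ≥0∞) = ENNReal.ofReal 32 by simp, ← ENNReal.ofReal_mul (by norm_num), hδsq]
      refine ENNReal.ofReal_le_ofReal ?_
      -- The risk is at least `L m N / (64 n)`; since `N ≥ 1`, `N ≥ (N + 1) / 2`, whence the
      -- constant `m / 128`.
      have h3 : 0 ≤ m * L * (N - 1) / n :=
        div_nonneg (mul_nonneg (by positivity) (by linarith)) (by positivity)
      have h4 : L / 2 * (m * N / n) - 32 * (m / 128 * L * (N + 1) / n) =
          m * L * (N - 1) / n / 4 := by ring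
      linarith
    exact (ENNReal.mul_le_mul_iff_right (by simp) (by simp)).1 h2
  calc ((m / 128 * L * (N + 1) / n : ℝ) : EReal)
      ≤ (ENNReal.ofReal (m / 128 * L * (N + 1) / n) : EReal) := by
        rw [EReal.coe_ennreal_ofReal]
        exact_mod_cast le_max_left _ _
    _ ≤ _ := by exact_mod_cast h1
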